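/- Let $A=\begin{pmatrix}a&b\\c&d\end{pmatrix}\in\mathbb{R}^{2\times2}$ be such that the zero-sum game with payoff matrix $A$ has a unique Nash equilibrium $(x^*,y^*)\in\triangle_2\times\triangle_2$, and this equilibrium is not a pure-strategy one. Put $$D=a-b-c+d,\qquad \Delta_{\min}=\min\{|a-b|,|a-c|,|d-b|,|d-c|\},$$ and let $\varepsilon\in\bigl(0,\tfrac{\Delta_{\min}^2}{3|D|}\bigr)$ and $\delta\in(0,1)$. An algorithm plays in each round an entry $(i,j)$, chosen from its internal randomness and the past plays and observations, and then observes an independent sample from $\mathcal N(A_{ij},1)$; it stops at a stopping time $\tau\in\mathbb{N}$ (the number of rounds played) and returns a pair of mixed strategies $(\hat x,\hat y)\in\triangle_2\times\triangle_2$. The algorithm does not know the matrix. Write $\mathbb{P}_B$, $\mathbb{E}_B$ for the law of the internal randomness and the observations when the matrix is $B$, and let $V_B^*=\max_{x\in\triangle_2}\min_{y\in\triangle_2}\langle x,By\rangle$. The algorithm is $(\varepsilon,\delta)$-PAC-good if for every $B\in\mathbb{R}^{2\times2}$ it stops $\mathbb{P}_B$-almost surely and $\mathbb{P}_B\bigl(|V_B^*-\langle\hat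 x,B\hat y\rangle|\le\varepsilon\bigr)\ge1-\delta$. Then every $(\varepsilon,\delta)$-PAC-good algorithm satisfies $$\mathbb{E}_A[\tau]\ \ge\ \frac{\log\bigl(1/(30\delta)\bigr)}{3\varepsilon|D|}.$$ -/

import Mathlib

open MeasureTheory ProbabilityTheory
open scoped ENNReal Matrix

noncomputable section

namespace MatrixGame

variable {m n : ℕ}

/-- The mixed strategies over `k` actions: the probability vectors in `ℝ^k`. -/
abbrev Mixed (k : ℕ) : Type := stdSimplex ℝ (Fin k)

/-- The expected payoff `⟨x, A y⟩` of the row player (the maximizer). -/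
def payoff (A : Matrix (Fin m) (Fin n) ℝ) (x : Mixed m) (y : Mixed n) : ℝ :=
  x.1 ⬝ᵥ (A *ᵥ y.1)

/-- The value `V_A^* = max_x min_y ⟨x, A y⟩` of the game. -/
def value (A : Matrix (Fin m) (Fin n) ℝ) : ℝ :=
  ⨆ x : Mixed m, ⨅ y : Mixed n, payoff A x y

/-- `p = (x, y)` is a Nash equilibrium of the zero-sum game `A`. -/
def IsNash (A : Matrix (Fin m) (Fin n) ℝ) (p : Mixed m × Mixed n) : Prop :=
  (∀ x' : Mixed m, payoff A x' p.2 ≤ payoff A p.1 p.2) ∧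
    ∀ y' : Mixed n, payoff A p.1 p.2 ≤ payoff A p.1 y'

/-- The support of a mixed strategy. -/
def supp {k : ℕ} (x : Mixed k) : Set (Fin k) := {i | 0 < x.1 i}

/-- Both players put all their mass on a single action. -/
def IsPure (p : Mixed m × Mixed n) : Prop :=
  ∃ i j, supp p.1 = {i} ∧ supp p.2 = {j}

/-- The game `A` has a unique Nash equilibrium, and that equilibrium is not a pure-strategy one. -/
def HasUniqueNonpureNash (A : Matrix (Fin m) (Fin n) ℝ) : Prop :=
  ∃ p, IsNash A p ∧ (∀ q, IsNash A q → q = p) ∧ ¬ IsPure p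

/-- A sequential sampling algorithm for `m × n` matrix games. Its internal randomness is a seed
drawn from an arbitrary probability space, independently of the observation noise. Given the seed
and the observations `Y_0, …, Y_{t-1}` of the first `t` rounds (the entries played in these rounds
are functions of these data), the algorithm decides whether it stops (`haltSet t`), what it outputs
if it stops (`output t`), and which entry it plays in round `t` otherwise (`sample t`).
The matrix itself is not an argument of any of the rules. -/
structure Algorithm (m n : ℕ) where
  /-- the space of the internal randomness -/
  Seed : Type*
  [measurableSpaceSeed : MeasurableSpace Seed]
  /-- the law of the internal randomness -/
  seedLaw : Measure Seed
  [isProbabilityMeasure_seedLaw : IsProbabilityMeasure seedLaw]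
  /-- the entry that is played in round `t` -/
  sample : (t : ℕ) → Seed × (Fin t → ℝ) → Fin m × Fin n
  measurable_sample : ∀ t, Measurable (sample t)
  /-- the data on which the algorithm stops after `t` rounds -/
  haltSet : (t : ℕ) → Set (Seed × (Fin t → ℝ))
  measurableSet_haltSet : ∀ t, MeasurableSet (haltSet t)
  /-- the pair of mixed strategies that is returned after `t` rounds -/
  output : (t : ℕ) → Seed × (Fin t → ℝ) → Mixed m × Mixed n
  measurable_output : ∀ t, Measurable (output t)

namespace Algorithm

attribute [instance] measurableSpaceSeed isProbabilityMeasure_seedLaw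

/-- A run of the algorithm (its stopping rule being ignored): the seed and all observations. -/
abbrev Run (alg : Algorithm m n) : Type _ := alg.Seed × (ℕ → ℝ)

/-- The data available after `t` rounds: the seed and the first `t` observations. -/
def history (alg : Algorithm m n) (t : ℕ) (ω : alg.Run) : alg.Seed × (Fin t → ℝ) :=
  (ω.1, fun s => ω.2 s)

/-- The observations as a function of the seed `u` and the noise sequence `ξ`: if entry `(i, j)` is
played in round `t`, then `A i j + ξ t` is observed. -/
def observe (alg : Algorithm m n) (A : Matrix (Fin m) (Fin n) ℝ) (u : alg.Seed) (ξ : ℕ → ℝ) :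
    ℕ → ℝ
  | t =>
    let p := alg.sample t (u, fun s : Fin t => observe alg A u ξ s)
    A p.1 p.2 + ξ t
decreasing_by exact s.2

/-- The law of the observation noise: independent standard Gaussians. -/
def noiseLaw : Measure (ℕ → ℝ) := Measure.infinitePi fun _ => gaussianReal 0 1

/-- The law `P_A` of the seed and the observations when the matrix is `A`. Playing `(i, j)` yields
an observation with law `N(A i j, 1)`, independent of the past given the entry played. -/
def law (alg : Algorithm m n) (A : Matrix (Fin m) (Fin n) ℝ) : Measure alg.Run :=
  (alg.seedLaw.prod noiseLaw).map fun p => (p.1, alg.observe A p.1 p.2)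

/-- The stopping time `τ`: the number of rounds played (`⊤` if the algorithm never stops). -/
def stoppingTime (alg : Algorithm m n) (ω : alg.Run) : ℕ∞ :=
  ⨅ (t : ℕ) (_ : alg.history t ω ∈ alg.haltSet t), (t : ℕ∞)

/-- The expected stopping time `E_A[τ]`, possibly infinite. -/
def expectedStoppingTime (alg : Algorithm m n) (A : Matrix (Fin m) (Fin n) ℝ) : ℝ≥0∞ :=
  ∫⁻ ω, (alg.stoppingTime ω : ℝ≥0∞) ∂(alg.law A)

/-- The algorithm stops on the run `ω`, and the pair `(x, y)` that it returns satisfies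
`|V_A^* - ⟨x, A y⟩| ≤ ε`. -/
def ReturnsGood (alg : Algorithm m n) (A : Matrix (Fin m) (Fin n) ℝ) (ε : ℝ) (ω : alg.Run) :
    Prop :=
  ∃ t : ℕ, alg.stoppingTime ω = t ∧
    |value A - payoff A (alg.output t (alg.history t ω)).1 (alg.output t (alg.history t ω)).2| ≤ ε

/-- `(ε, δ)`-PAC-good: for every matrix `A`, the algorithm stops almost surely, and with
probability at least `1 - δ` it returns an `ε`-good solution. -/
def IsPACGood (alg : Algorithm m n) (ε δ : ℝ) : Prop :=
  ∀ A : Matrix (Fin m) (Fin n) ℝ,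
    (∀ᵐ ω ∂(alg.law A), alg.stoppingTime ω < ⊤) ∧
      ENNReal.ofReal (1 - δ) ≤ alg.law A {ω | alg.ReturnsGood A ε ω}

theorem observe_eq (alg : Algorithm m n) (A : Matrix (Fin m) (Fin n) ℝ) (u : alg.Seed)
    (ξ : ℕ → ℝ) (t : ℕ) :
    alg.observe A u ξ t =
      A (alg.sample t (u, fun s : Fin t => alg.observe A u ξ s)).1
        (alg.sample t (u, fun s : Fin t => alg.observe A u ξ s)).2 + ξ t := by
  rw [observe]

theorem measurable_observe (alg : Algorithm m n) (A : Matrix (Fin m) (Fin n) ℝ) :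
    Measurable fun p : alg.Seed × (ℕ → ℝ) => (p.1, alg.observe A p.1 p.2) := by
  refine measurable_fst.prodMk (measurable_pi_lambda _ fun t => ?_)
  induction t using Nat.strong_induction_on with
  | _ t ih =>
    have h : Measurable fun p : alg.Seed × (ℕ → ℝ) =>
        alg.sample t (p.1, fun s : Fin t => alg.observe A p.1 p.2 s) :=
      (alg.measurable_sample t).comp
        (measurable_fst.prodMk (measurable_pi_lambda _ fun s => ih s s.2))
    have hA : Measurable fun q : Fin m × Fin n => A q.1 q.2 := Measurable.of_discrete
    have hξ : Measurable fun p : alg.Seed × (ℕ → ℝ) => p.2 t :=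
      (measurable_pi_apply t).comp measurable_snd
    simp_rw [observe_eq alg A _ _ t]
    exact (hA.comp h).add hξ

instance (alg : Algorithm m n) (A : Matrix (Fin m) (Fin n) ℝ) :
    IsProbabilityMeasure (alg.law A) := by
  have : IsProbabilityMeasure noiseLaw := by unfold noiseLaw; infer_instance
  exact Measure.isProbabilityMeasure_map (alg.measurable_observe A).aemeasurable

end Algorithm

/-- `D = a - b - c + d` for the matrix `[a, b; c, d]`. -/
def gameD (a b c d : ℝ) : ℝ := a - b - c + d

/-- `Δ_min = min {|a - b|, |a - c|, |d - b|, |d - c|}` for the matrix `[a, b; c, d]`. -/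
def gapMin (a b c d : ℝ) : ℝ := min (min |a - b| |a - c|) (min |d - b| |d - c|)

end MatrixGame

end

/-!
Put `σ = √(3 ε |D|)`, which is less than `Δ_min` by the bound on `ε`. The best replies in
`[a, b; c, d]` run in a cycle, and this persists when every gap is changed by at most `σ`. For such
a game `B` the error of a pair of strategies factors as
`D (⟨x, B y⟩ - V_B) = (D x₀ - (d_B - c_B)) (D y₀ - (d_B - b_B))`.
Perturbing the two entries on a diagonal by `σ` and `-σ` keeps `D` fixed and shifts
`d - c` and `d - b` by `±σ`; all four combinations of signs occur (`shiftedGame`). For a given pair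
`(x, y)`, choose the signs so that both factors have modulus at
least `σ`: the error for that alternative is at least `σ ^ 2 / |D| = 3 ε`. So every output is bad
for one of the four alternatives (`exists_shiftedGame_lt_abs_sub`), although an `(ε, δ)`-PAC-good
algorithm errs with probability at most `δ` on each of them.

The rest is information theory. Let `L` be the log-likelihood ratio of `A` against an alternative
`B` for the observations made before `min τ t`. If `R` is an event decided by that time, then the
change of measure `lintegral_law_eq_lintegral_logLR` gives
`E_A[exp (-L + log (1 / δ) 1_R)] = P_B(Rᶜ) + P_B(R) / δ ≤ 2` when `P_B(R) ≤ δ`, and by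
`1 + x ≤ exp x` it follows that `E_A[L] ≥ P_A(R) log (1 / δ) - log 2`
(`measureReal_mul_log_sub_le_integral_entropySum`). As `L` is, up to a martingale, the sum of
`(A i j - B i j) ^ 2 / 2` over the entries `(i, j)` played, and each entry is moved by `σ` in two
of the four alternatives, adding up the four inequalities yields
`σ ^ 2 E_A[min τ t] ≥ P_A(τ < t) log (1 / δ) - 4 log 2`. Letting `t → ∞` gives the bound, with `16`
in place of `30`.
-/

noncomputable section

namespace MatrixGame

/-! ### Gaussian noise -/

/-- A translate of the standard Gaussian against another one: the density is the likelihood ratio. -/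
theorem lintegral_gaussianReal_translate (a b : ℝ) {h : ℝ → ℝ≥0∞} (hh : Measurable h) :
    ∫⁻ x, h (b + x) ∂gaussianReal 0 1 =
      ∫⁻ x, h (a + x) * ENNReal.ofReal (Real.exp (-(((a + x - b) ^ 2 - (a + x - a) ^ 2) / 2)))
        ∂gaussianReal 0 1 := by
  have key : ∀ (c : ℝ) (k : ℝ → ℝ≥0∞), Measurable k →
      ∫⁻ x, k (c + x) ∂gaussianReal 0 1 = ∫⁻ z, gaussianPDF c 1 z * k z := by
    intro c k hk
    have h1 : ∫⁻ x, k (c + x) ∂gaussianReal 0 1 = ∫⁻ z, k z ∂gaussianReal c 1 := by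
      have := gaussianReal_map_const_add (μ := 0) (v := 1) c
      rw [zero_add] at this
      rw [← this, lintegral_map hk (by fun_prop)]
    rw [h1, gaussianReal_of_var_ne_zero _ one_ne_zero,
      lintegral_withDensity_eq_lintegral_mul _ (measurable_gaussianPDF c 1) hk]
    rfl
  rw [key b h hh, key a (fun z => h z *
    ENNReal.ofReal (Real.exp (-(((z - b) ^ 2 - (z - a) ^ 2) / 2)))) (by fun_prop)]
  refine lintegral_congr fun z => ?_
  rw [mul_comm (h z), ← mul_assoc]
  congr 1
  rw [gaussianPDF, gaussianPDF, ← ENNReal.ofReal_mul (gaussianPDFReal_nonneg _ _ _)]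
  congr 1
  simp only [gaussianPDFReal]
  rw [mul_assoc _ (Real.exp _) (Real.exp _), ← Real.exp_add]
  congr 2
  push_cast
  ring

namespace Algorithm

instance : IsProbabilityMeasure noiseLaw := by
  unfold noiseLaw
  infer_instance

/-- Replacing one coordinate of the noise by a fresh standard Gaussian preserves the noise law. -/
theorem measurePreserving_update_noise (n : ℕ) :
    MeasurePreserving (fun p : (ℕ → ℝ) × ℝ => Function.update p.1 n p.2)
      (noiseLaw.prod (gaussianReal 0 1)) noiseLaw := by
  refine ⟨measurable_update', ?_⟩
  refine Measure.eq_infinitePi _ fun s t ht => ?_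
  rw [Measure.map_apply measurable_update' (.pi s.countable_toSet fun i _ => ht i)]
  have hpre : (fun p : (ℕ → ℝ) × ℝ => Function.update p.1 n p.2) ⁻¹' Set.pi s t =
      (Set.pi (s.erase n : Finset ℕ) t) ×ˢ (if n ∈ s then t n else Set.univ) := by
    ext ⟨ξ, x⟩
    simp only [Set.mem_preimage, Set.mem_pi, Finset.mem_coe, Set.mem_prod, Finset.mem_erase]
    constructor
    · intro h
      refine ⟨fun i hi => ?_, ?_⟩
      · simpa [Function.update_of_ne hi.1] using h i hi.2
      · split_ifs with hn
        · simpa using h n hn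
        · trivial
    · rintro ⟨h1, h2⟩ i hi
      rcases eq_or_ne i n with rfl | hin
      · simpa [hi] using h2
      · simpa [Function.update_of_ne hin] using h1 i ⟨hin, hi⟩
  rw [hpre, Measure.prod_prod, noiseLaw, Measure.infinitePi_pi _ fun i _ => ht i]
  split_ifs with hn
  · rw [mul_comm, Finset.mul_prod_erase s (fun i => gaussianReal 0 1 (t i)) hn]
  · rw [Finset.erase_eq_of_notMem hn, measure_univ, mul_one]

variable {m n : ℕ} (alg : Algorithm m n)

theorem measurePreserving_update_seed_noise (t : ℕ) :
    MeasurePreserving (fun p : (alg.Seed × (ℕ → ℝ)) × ℝ => (p.1.1, Function.update p.1.2 t p.2))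
      ((alg.seedLaw.prod noiseLaw).prod (gaussianReal 0 1)) (alg.seedLaw.prod noiseLaw) := by
  have h1 := (MeasurePreserving.id alg.seedLaw).prod (measurePreserving_update_noise t)
  have h2 := measurePreserving_prodAssoc alg.seedLaw noiseLaw (gaussianReal 0 1)
  exact h1.comp h2

/-! ### Runs of the algorithm -/

/-- The mean of the observation of round `t` when the matrix is `A`: the entry of `A` played. -/
def mean (A : Matrix (Fin m) (Fin n) ℝ) (t : ℕ) (ω : alg.Run) : ℝ :=
  A (alg.sample t (alg.history t ω)).1 (alg.sample t (alg.history t ω)).2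

theorem measurable_history (t : ℕ) : Measurable (alg.history t) :=
  measurable_fst.prodMk
    (measurable_pi_lambda _ fun s => (measurable_pi_apply (s : ℕ)).comp measurable_snd)

theorem measurable_mean (A : Matrix (Fin m) (Fin n) ℝ) (t : ℕ) : Measurable (alg.mean A t) := by
  have hA : Measurable fun q : Fin m × Fin n => A q.1 q.2 := Measurable.of_discrete
  exact hA.comp ((alg.measurable_sample t).comp (alg.measurable_history t))

theorem observe_eq_mean_add (A : Matrix (Fin m) (Fin n) ℝ) (u : alg.Seed) (ξ : ℕ → ℝ) (t : ℕ) :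
    alg.observe A u ξ t = alg.mean A t (u, alg.observe A u ξ) + ξ t :=
  alg.observe_eq A u ξ t

theorem history_congr {t : ℕ} (u : alg.Seed) {y y' : ℕ → ℝ} (h : ∀ s < t, y s = y' s) :
    alg.history t (u, y) = alg.history t (u, y') := by
  simp only [history]
  congr 1
  funext s
  exact h s s.2

theorem mean_congr (A : Matrix (Fin m) (Fin n) ℝ) {t : ℕ} (u : alg.Seed) {y y' : ℕ → ℝ}
    (h : ∀ s < t, y s = y' s) : alg.mean A t (u, y) = alg.mean A t (u, y') := by
  rw [mean, mean, alg.history_congr u h]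

theorem observe_congr (A : Matrix (Fin m) (Fin n) ℝ) (u : alg.Seed) {ξ ξ' : ℕ → ℝ} {t : ℕ}
    (h : ∀ s ≤ t, ξ s = ξ' s) : alg.observe A u ξ t = alg.observe A u ξ' t := by
  induction t using Nat.strong_induction_on with
  | _ t ih =>
    rw [observe_eq_mean_add, observe_eq_mean_add, h t le_rfl,
      alg.mean_congr A u fun s hs => ih s hs fun r hr => h r (hr.trans hs.le)]

theorem observe_update_of_lt (A : Matrix (Fin m) (Fin n) ℝ) (u : alg.Seed) (ξ : ℕ → ℝ) (x : ℝ)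
    {s t : ℕ} (h : s < t) :
    alg.observe A u (Function.update ξ t x) s = alg.observe A u ξ s :=
  alg.observe_congr A u fun r hr => Function.update_of_ne (by omega) _ _

theorem observe_update_self (A : Matrix (Fin m) (Fin n) ℝ) (u : alg.Seed) (ξ : ℕ → ℝ) (x : ℝ)
    (t : ℕ) :
    alg.observe A u (Function.update ξ t x) t = alg.mean A t (u, alg.observe A u ξ) + x := by
  rw [observe_eq_mean_add, Function.update_self,
    alg.mean_congr A u fun s hs => alg.observe_update_of_lt A u ξ x hs]

/-- The law of the first `t + 1` observations, disintegrated over the first `t` of them. -/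
theorem lintegral_law_step (A : Matrix (Fin m) (Fin n) ℝ) (t : ℕ) {F : alg.Run → ℝ≥0∞}
    (hF : Measurable F)
    (hdet : ∀ u y y', (∀ s ≤ t, y s = y' s) → F (u, y) = F (u, y')) :
    ∫⁻ ω, F ω ∂alg.law A =
      ∫⁻ ω, ∫⁻ x, F (ω.1, Function.update ω.2 t (alg.mean A t ω + x)) ∂gaussianReal 0 1
        ∂alg.law A := by
  have hm := alg.measurable_observe A
  have hmean := alg.measurable_mean A t
  have hstep : Measurable fun p : alg.Run × ℝ =>
      ((p.1.1, Function.update p.1.2 t (alg.mean A t p.1 + p.2)) : alg.Run) :=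
    (measurable_fst.comp measurable_fst).prodMk
      (measurable_update'.comp ((measurable_snd.comp measurable_fst).prodMk
        ((hmean.comp measurable_fst).add measurable_snd)))
  have hinner : Measurable fun ω : alg.Run =>
      ∫⁻ x, F (ω.1, Function.update ω.2 t (alg.mean A t ω + x)) ∂gaussianReal 0 1 :=
    (hF.comp hstep).lintegral_prod_right'
  rw [law, lintegral_map hF hm, lintegral_map hinner hm]
  have hmp := alg.measurePreserving_update_seed_noise t
  refine (hmp.lintegral_comp (hF.comp hm)).symm.trans ?_
  refine (lintegral_prod _ ((hF.comp hm).comp hmp.measurable).aemeasurable).trans ?_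
  refine lintegral_congr fun p => lintegral_congr fun x => hdet _ _ _ fun s hs => ?_
  rcases hs.lt_or_eq with hs | rfl
  · rw [Function.update_of_ne hs.ne]
    exact alg.observe_update_of_lt A _ _ _ hs
  · rw [Function.update_self]
    exact alg.observe_update_self A _ _ _ _

/-! ### The stopping time -/

theorem lt_stoppingTime_iff {s : ℕ} {ω : alg.Run} :
    (s : ℕ∞) < alg.stoppingTime ω ↔ ∀ r ≤ s, alg.history r ω ∉ alg.haltSet r := by
  rw [← not_le, stoppingTime]
  constructor
  · intro h r hr hmem
    exact h ((iInf₂_le r hmem).trans (by exact_mod_cast hr))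
  · intro h hle
    have : ((s + 1 : ℕ) : ℕ∞) ≤
        ⨅ (t : ℕ) (_ : alg.history t ω ∈ alg.haltSet t), (t : ℕ∞) := by
      refine le_iInf₂ fun t ht => ?_
      have : s < t := by
        by_contra hst
        exact h t (not_lt.1 hst) ht
      exact_mod_cast this
    have := this.trans hle
    norm_cast at this
    omega

theorem lt_stoppingTime_congr {s : ℕ} (u : alg.Seed) {y y' : ℕ → ℝ} (h : ∀ r < s, y r = y' r) :
    (s : ℕ∞) < alg.stoppingTime (u, y) ↔ (s : ℕ∞) < alg.stoppingTime (u, y') := by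
  simp only [lt_stoppingTime_iff]
  refine forall₂_congr fun r hr => ?_
  rw [alg.history_congr u fun q hq => h q (hq.trans_le hr)]

theorem measurableSet_lt_stoppingTime (s : ℕ) :
    MeasurableSet {ω : alg.Run | (s : ℕ∞) < alg.stoppingTime ω} := by
  simp only [lt_stoppingTime_iff, Set.ofPred_forall]
  exact .iInter fun r => .iInter fun _ =>
    ((alg.measurableSet_haltSet r).preimage (alg.measurable_history r)).compl

/-- `f` is a function of the data available at time `min τ t`: changing the observations that are
made in round `t` or later, or after the algorithm has stopped, does not change its value. -/
def DeterminedBy {β : Type*} (t : ℕ) (f : alg.Run → β) : Prop :=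
  ∀ u y y', (∀ s < t, (s : ℕ∞) < alg.stoppingTime (u, y) → y s = y' s) → f (u, y) = f (u, y')

theorem lt_stoppingTime_congr_of_agree {t : ℕ} {u : alg.Seed} {y y' : ℕ → ℝ}
    (h : ∀ s < t, (s : ℕ∞) < alg.stoppingTime (u, y) → y s = y' s) {s : ℕ} (hs : s ≤ t) :
    (s : ℕ∞) < alg.stoppingTime (u, y) ↔ (s : ℕ∞) < alg.stoppingTime (u, y') := by
  induction s with
  | zero => exact alg.lt_stoppingTime_congr u fun r hr => absurd hr (Nat.not_lt_zero r)
  | succ s ih =>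
    by_cases hrun : (s : ℕ∞) < alg.stoppingTime (u, y)
    · exact alg.lt_stoppingTime_congr u fun r hr =>
        h r (by omega) (lt_of_le_of_lt (by exact_mod_cast Nat.lt_succ_iff.1 hr) hrun)
    · have hrun' := mt (ih (by omega)).2 hrun
      have hle : ((s : ℕ) : ℕ∞) ≤ ((s + 1 : ℕ) : ℕ∞) := by exact_mod_cast Nat.le_succ s
      exact iff_of_false (fun h' => hrun (hle.trans_lt h')) fun h' => hrun' (hle.trans_lt h')

open Classical in
/-- The log-likelihood ratio of `A` against `B` of the observations made before `min τ t`. -/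
def logLR (A B : Matrix (Fin m) (Fin n) ℝ) (t : ℕ) (ω : alg.Run) : ℝ :=
  ∑ s ∈ Finset.range t, if (s : ℕ∞) < alg.stoppingTime ω then
    ((ω.2 s - alg.mean B s ω) ^ 2 - (ω.2 s - alg.mean A s ω) ^ 2) / 2 else 0

theorem measurable_logLR (A B : Matrix (Fin m) (Fin n) ℝ) (t : ℕ) :
    Measurable (alg.logLR A B t) := by
  refine Finset.measurable_sum _ fun s _ =>
    Measurable.ite (alg.measurableSet_lt_stoppingTime s) ?_ measurable_const
  have hy : Measurable fun ω : alg.Run => ω.2 s := (measurable_pi_apply s).comp measurable_snd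
  exact (((hy.sub (alg.measurable_mean B s)).pow_const 2).sub
    ((hy.sub (alg.measurable_mean A s)).pow_const 2)).div_const 2

theorem logLR_congr (A B : Matrix (Fin m) (Fin n) ℝ) (t : ℕ) (u : alg.Seed) {y y' : ℕ → ℝ}
    (h : ∀ s < t, y s = y' s) : alg.logLR A B t (u, y) = alg.logLR A B t (u, y') := by
  classical
  refine Finset.sum_congr rfl fun s hs => ?_
  have hs : s < t := Finset.mem_range.1 hs
  have h' : ∀ r < s, y r = y' r := fun r hr => h r (hr.trans hs)
  simp only [alg.lt_stoppingTime_congr u h', alg.mean_congr A u h', alg.mean_congr B u h', h s hs]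

/-- Change of measure at the bounded stopping time `min τ t`. -/
theorem lintegral_law_eq_lintegral_logLR (A B : Matrix (Fin m) (Fin n) ℝ) (t : ℕ) :
    ∀ {f : alg.Run → ℝ≥0∞}, Measurable f → alg.DeterminedBy t f →
      ∫⁻ ω, f ω ∂alg.law B =
        ∫⁻ ω, f ω * ENNReal.ofReal (Real.exp (-alg.logLR A B t ω)) ∂alg.law A := by
  induction t with
  | zero =>
    intro f hf hdet
    have h0 : ∀ (C : Matrix (Fin m) (Fin n) ℝ),
        ∫⁻ ω, f ω ∂alg.law C = ∫⁻ p, f (p.1, 0) ∂(alg.seedLaw.prod noiseLaw) := by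
      intro C
      rw [law, lintegral_map hf (alg.measurable_observe C)]
      exact lintegral_congr fun p => hdet _ _ _ fun s hs => absurd hs (Nat.not_lt_zero s)
    simp only [logLR, Finset.range_zero, Finset.sum_empty, neg_zero, Real.exp_zero,
      ENNReal.ofReal_one, mul_one]
    rw [h0 A, h0 B]
  | succ t ih =>
    intro f hf hdet
    -- the value of `f` after one more observation `z` in round `t`
    let g : alg.Run → ℝ → ℝ≥0∞ := fun ω z => f (ω.1, Function.update ω.2 t z)
    have hupd : Measurable fun p : alg.Run × ℝ =>
        ((p.1.1, Function.update p.1.2 t p.2) : alg.Run) :=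
      (measurable_fst.comp measurable_fst).prodMk
        (measurable_update'.comp ((measurable_snd.comp measurable_fst).prodMk measurable_snd))
    have hg : Measurable fun p : alg.Run × ℝ => g p.1 p.2 := hf.comp hupd
    have hplain : ∀ u y y', (∀ s ≤ t, y s = y' s) → f (u, y) = f (u, y') :=
      fun u y y' h => hdet u y y' fun s hs _ => h s (Nat.lt_succ_iff.1 hs)
    have hrun_upd : ∀ (u : alg.Seed) (y : ℕ → ℝ) (z : ℝ) {s : ℕ}, s ≤ t →
        ((s : ℕ∞) < alg.stoppingTime (u, Function.update y t z) ↔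
          (s : ℕ∞) < alg.stoppingTime (u, y)) := fun u y z s hs =>
      alg.lt_stoppingTime_congr u fun r hr => Function.update_of_ne (by omega) _ _
    have hf'meas : Measurable fun ω : alg.Run =>
        ∫⁻ x, g ω (alg.mean B t ω + x) ∂gaussianReal 0 1 := by
      have : Measurable fun p : alg.Run × ℝ => g p.1 (alg.mean B t p.1 + p.2) :=
        hg.comp (measurable_fst.prodMk
          (((alg.measurable_mean B t).comp measurable_fst).add measurable_snd))
      exact this.lintegral_prod_right'
    have hf'det : alg.DeterminedBy t fun ω : alg.Run =>
        ∫⁻ x, g ω (alg.mean B t ω + x) ∂gaussianReal 0 1 := by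
      intro u y y' h
      refine lintegral_congr fun x => hdet _ _ _ fun s hs hrun => ?_
      rw [hrun_upd u y _ (Nat.lt_succ_iff.1 hs)] at hrun
      rcases (Nat.lt_succ_iff.1 hs).lt_or_eq with hst | rfl
      · rw [Function.update_of_ne hst.ne, Function.update_of_ne hst.ne]
        exact h s hst hrun
      · rw [Function.update_self, Function.update_self, alg.mean_congr B u fun r hr =>
          h r hr (lt_trans (by exact_mod_cast hr) hrun)]
    -- the integrand on the right-hand side after one more observation under `A`
    have hG : Measurable fun ω => f ω * ENNReal.ofReal (Real.exp (-alg.logLR A B (t + 1) ω)) :=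
      hf.mul (Real.measurable_exp.comp (alg.measurable_logLR A B (t + 1)).neg).ennreal_ofReal
    rw [alg.lintegral_law_step B t hf hplain, ih hf'meas hf'det,
      alg.lintegral_law_step A t hG fun u y y' h => by
        rw [hplain u y y' h, alg.logLR_congr A B (t + 1) u fun s hs => h s (by omega)]]
    refine lintegral_congr fun ω => ?_
    obtain ⟨u, y⟩ := ω
    set a := alg.mean A t (u, y) with ha
    set b := alg.mean B t (u, y) with hb
    have hgu : Measurable (g (u, y)) := hg.comp measurable_prodMk_left
    have hlr : ∀ z, alg.logLR A B (t + 1) (u, Function.update y t z) =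
        alg.logLR A B t (u, y) + if (t : ℕ∞) < alg.stoppingTime (u, y) then
          ((z - b) ^ 2 - (z - a) ^ 2) / 2 else 0 := by
      intro z
      have hlt : ∀ r < t, Function.update y t z r = y r :=
        fun r hr => Function.update_of_ne hr.ne _ _
      rw [← alg.logLR_congr A B t u hlt, logLR, Finset.sum_range_succ, ← logLR,
        alg.mean_congr A u hlt, alg.mean_congr B u hlt]
      simp only [Function.update_self, hrun_upd u y z le_rfl]
      rfl
    have hexp : ∀ v w : ℝ, ENNReal.ofReal (Real.exp (-(v + w))) =
        ENNReal.ofReal (Real.exp (-w)) * ENNReal.ofReal (Real.exp (-v)) := by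
      intro v w
      rw [← ENNReal.ofReal_mul (Real.exp_nonneg _), ← Real.exp_add]
      congr 2
      ring
    simp only [hlr, hexp, ← mul_assoc]
    rw [lintegral_mul_const']
    swap
    · exact ENNReal.ofReal_ne_top
    congr 1
    by_cases hrun : (t : ℕ∞) < alg.stoppingTime (u, y)
    · simp only [hrun, if_true]
      exact lintegral_gaussianReal_translate a b hgu
    · simp only [hrun, if_false, neg_zero, Real.exp_zero, ENNReal.ofReal_one, mul_one]
      refine lintegral_congr fun x => hdet _ _ _ fun s hs hs' => ?_
      rw [hrun_upd u y _ (Nat.lt_succ_iff.1 hs)] at hs'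
      rcases (Nat.lt_succ_iff.1 hs).lt_or_eq with hst | rfl
      · rw [Function.update_of_ne hst.ne, Function.update_of_ne hst.ne]
      · exact absurd hs' hrun

end Algorithm

/-! ### Values of matrix games -/

section Game

variable {m n : ℕ}

theorem continuous_payoff (A : Matrix (Fin m) (Fin n) ℝ) :
    Continuous fun p : Mixed m × Mixed n => payoff A p.1 p.2 := by
  simp only [payoff, dotProduct, Matrix.mulVec]
  refine continuous_finsetSum _ fun i _ => Continuous.mul
    ((continuous_apply i).comp (continuous_subtype_val.comp continuous_fst))
    (continuous_finsetSum _ fun j _ => continuous_const.mul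
      ((continuous_apply j).comp (continuous_subtype_val.comp continuous_snd)))

theorem value_eq_of_equalizing {A : Matrix (Fin m) (Fin n) ℝ} {x₀ : Mixed m} {y₀ : Mixed n} {v : ℝ}
    (hx : ∀ y, payoff A x₀ y = v) (hy : ∀ x, payoff A x y₀ = v) : value A = v := by
  have hle : ∀ x, ⨅ y, payoff A x y ≤ v := fun x =>
    (ciInf_le (isCompact_range ((continuous_payoff A).comp
      (Continuous.prodMk_right x))).bddBelow y₀).trans_eq (hy x)
  have : Nonempty (Mixed m) := ⟨x₀⟩
  have : Nonempty (Mixed n) := ⟨y₀⟩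
  refine le_antisymm (ciSup_le hle) ?_
  calc v = ⨅ y, payoff A x₀ y := by simp only [hx, ciInf_const]
    _ ≤ value A := le_ciSup (f := fun x => ⨅ y, payoff A x y)
      ⟨v, Set.forall_mem_range.2 hle⟩ x₀

/-- The mixed strategy that plays the action `i`. -/
def pureStrategy {k : ℕ} (i : Fin k) : Mixed k := ⟨Pi.single i 1, single_mem_stdSimplex ℝ i⟩

theorem supp_pureStrategy {k : ℕ} (i : Fin k) : supp (pureStrategy i) = {i} := by
  ext j
  rcases eq_or_ne j i with rfl | h
  · simp [supp, pureStrategy]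
  · simp [supp, pureStrategy, h]

theorem isNash_pureStrategy {A : Matrix (Fin m) (Fin n) ℝ} {i : Fin m} {j : Fin n}
    (hrow : ∀ i', A i' j ≤ A i j) (hcol : ∀ j', A i j ≤ A i j') :
    IsNash A (pureStrategy i, pureStrategy j) := by
  have hy : ∀ x : Mixed m, payoff A x (pureStrategy j) = ∑ i', x.1 i' * A i' j := fun x => by
    simp [payoff, pureStrategy, dotProduct]
  have hx : ∀ y : Mixed n, payoff A (pureStrategy i) y = ∑ j', A i j' * y.1 j' := fun y =>
    single_one_dotProduct _ _
  have hij : payoff A (pureStrategy i) (pureStrategy j) = A i j := by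
    rw [hx]
    exact dotProduct_single_one _ _
  refine ⟨fun x => ?_, fun y => ?_⟩
  · rw [hij, hy]
    calc _ ≤ ∑ i', x.1 i' * A i j :=
          Finset.sum_le_sum fun i' _ => mul_le_mul_of_nonneg_left (hrow i') (x.2.1 i')
      _ = A i j := by rw [← Finset.sum_mul, x.2.2, one_mul]
  · rw [hij, hx]
    calc A i j = ∑ j', A i j * y.1 j' := by rw [← Finset.mul_sum, y.2.2, mul_one]
      _ ≤ _ := Finset.sum_le_sum fun j' _ => mul_le_mul_of_nonneg_right (hcol j') (y.2.1 j')

theorem HasUniqueNonpureNash.not_saddle {A : Matrix (Fin m) (Fin n) ℝ}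
    (hA : HasUniqueNonpureNash A) (i : Fin m) (j : Fin n) :
    ¬ ((∀ i', A i' j ≤ A i j) ∧ ∀ j', A i j ≤ A i j') := by
  rintro ⟨hrow, hcol⟩
  obtain ⟨p, -, huniq, hpure⟩ := hA
  rw [← huniq _ (isNash_pureStrategy hrow hcol)] at hpure
  exact hpure ⟨i, j, supp_pureStrategy i, supp_pureStrategy j⟩

/-! ### Games without a pure equilibrium -/

/-- The best replies in the game `[a, b; c, d]` run in a cycle through the four entries, so that
there is no pure equilibrium, and the mixed equilibrium has full support. -/
def IsCyclic (a b c d : ℝ) : Prop :=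
  (b < a ∧ c < a ∧ b < d ∧ c < d) ∨ (a < b ∧ a < c ∧ d < b ∧ d < c)

theorem HasUniqueNonpureNash.isCyclic {a b c d : ℝ} (hA : HasUniqueNonpureNash !![a, b; c, d]) :
    IsCyclic a b c d := by
  have h00 := hA.not_saddle 0 0
  have h01 := hA.not_saddle 0 1
  have h10 := hA.not_saddle 1 0
  have h11 := hA.not_saddle 1 1
  simp [Fin.forall_fin_two] at h00 h01 h10 h11
  unfold IsCyclic
  grind

theorem payoff_fin_two (a b c d : ℝ) (x y : Mixed 2) :
    payoff !![a, b; c, d] x y =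
      x.1 0 * (a * y.1 0 + b * (1 - y.1 0)) + (1 - x.1 0) * (c * y.1 0 + d * (1 - y.1 0)) := by
  have hx : x.1 1 = 1 - x.1 0 := by
    have := x.2.2
    rw [Fin.sum_univ_two] at this
    linarith
  have hy : y.1 1 = 1 - y.1 0 := by
    have := y.2.2
    rw [Fin.sum_univ_two] at this
    linarith
  simp [payoff, dotProduct, Matrix.mulVec, Fin.sum_univ_two, hx, hy]

theorem IsCyclic.gameD_ne_zero {a b c d : ℝ} (h : IsCyclic a b c d) : gameD a b c d ≠ 0 := by
  unfold gameD
  rcases h with h | h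
  · exact ne_of_gt (by linarith)
  · exact ne_of_lt (by linarith)

/-- The suboptimality of `(x, y)` factors: it is the product of the distances of `x` and of `y` to
the equilibrium strategies, up to the scaling by `D`. -/
theorem IsCyclic.gameD_mul_payoff_sub_value {a b c d : ℝ} (h : IsCyclic a b c d) (x y : Mixed 2) :
    gameD a b c d * (payoff !![a, b; c, d] x y - value !![a, b; c, d]) =
      (gameD a b c d * x.1 0 - (d - c)) * (gameD a b c d * y.1 0 - (d - b)) := by
  have hD := h.gameD_ne_zero
  have hmix : ∀ p q : ℝ, p + q = gameD a b c d → ((0 < p ∧ 0 < q) ∨ (p < 0 ∧ q < 0)) →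
      ∃ z : Mixed 2, z.1 0 = p / gameD a b c d := by
    intro p q hpq hsign
    refine ⟨⟨![p / gameD a b c d, q / gameD a b c d], ?_, ?_⟩, rfl⟩
    · rw [Fin.forall_fin_two, ← hpq]
      rcases hsign with ⟨hp, hq⟩ | ⟨hp, hq⟩
      · exact ⟨div_nonneg hp.le (by linarith), div_nonneg hq.le (by linarith)⟩
      · exact ⟨div_nonneg_of_nonpos hp.le (by linarith), div_nonneg_of_nonpos hq.le (by linarith)⟩
    · rw [Fin.sum_univ_two]
      simp only [Matrix.cons_val_zero, Matrix.cons_val_one]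
      rw [← add_div, hpq, div_self hD]
  obtain ⟨x₀, hx₀⟩ := hmix (d - c) (a - b) (by unfold gameD; ring) <| by
    rcases h with h | h
    · exact .inl ⟨by linarith, by linarith⟩
    · exact .inr ⟨by linarith, by linarith⟩
  obtain ⟨y₀, hy₀⟩ := hmix (d - b) (a - c) (by unfold gameD; ring) <| by
    rcases h with h | h
    · exact .inl ⟨by linarith, by linarith⟩
    · exact .inr ⟨by linarith, by linarith⟩
  have hv : value !![a, b; c, d] = (a * d - b * c) / gameD a b c d := by
    refine value_eq_of_equalizing (x₀ := x₀) (y₀ := y₀) (fun y => ?_) fun x => ?_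
    · rw [payoff_fin_two, hx₀]
      field_simp
      unfold gameD
      ring
    · rw [payoff_fin_two, hy₀]
      field_simp
      unfold gameD
      ring
  rw [hv, payoff_fin_two, mul_sub, mul_div_cancel₀ _ hD]
  unfold gameD
  ring

/-! ### The alternatives -/

/-- The game `[a, b; c, d]` perturbed so that `D` stays the same, while the equilibrium strategies
`((d - c) / D, (a - b) / D)` and `((d - b) / D, (a - c) / D)` are shifted by `r / D` and `s / D`. -/
def shiftedGame (a b c d r s : ℝ) : Matrix (Fin 2) (Fin 2) ℝ :=
  !![a - (r + s) / 2, b + (r - s) / 2; c + (s - r) / 2, d + (r + s) / 2]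

theorem abs_gameD_mul_abs_value_shiftedGame_sub {a b c d r s : ℝ} (h : IsCyclic a b c d)
    (hr : |r| < gapMin a b c d) (hs : |s| < gapMin a b c d) (x y : Mixed 2) :
    |gameD a b c d| * |value (shiftedGame a b c d r s) - payoff (shiftedGame a b c d r s) x y| =
      |gameD a b c d * x.1 0 - (d - c) - r| * |gameD a b c d * y.1 0 - (d - b) - s| := by
  have h' : IsCyclic (a - (r + s) / 2) (b + (r - s) / 2) (c + (s - r) / 2) (d + (r + s) / 2) := by
    unfold gapMin at hr hs
    simp only [lt_min_iff] at hr hs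
    obtain ⟨⟨hr1, hr2⟩, hr3, hr4⟩ := hr
    obtain ⟨⟨hs1, hs2⟩, hs3, hs4⟩ := hs
    have hr := abs_le.1 (le_refl |r|)
    have hs := abs_le.1 (le_refl |s|)
    rcases h with ⟨h1, h2, h3, h4⟩ | ⟨h1, h2, h3, h4⟩
    · rw [abs_of_pos (sub_pos.2 h1)] at hr1 hs1
      rw [abs_of_pos (sub_pos.2 h2)] at hr2 hs2
      rw [abs_of_pos (sub_pos.2 h3)] at hr3 hs3
      rw [abs_of_pos (sub_pos.2 h4)] at hr4 hs4
      exact .inl ⟨by linarith, by linarith, by linarith, by linarith⟩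
    · rw [abs_of_neg (sub_neg.2 h1)] at hr1 hs1
      rw [abs_of_neg (sub_neg.2 h2)] at hr2 hs2
      rw [abs_of_neg (sub_neg.2 h3)] at hr3 hs3
      rw [abs_of_neg (sub_neg.2 h4)] at hr4 hs4
      exact .inr ⟨by linarith, by linarith, by linarith, by linarith⟩
  have hD : gameD (a - (r + s) / 2) (b + (r - s) / 2) (c + (s - r) / 2) (d + (r + s) / 2) =
      gameD a b c d := by
    unfold gameD
    ring
  have key := h'.gameD_mul_payoff_sub_value x y
  rw [hD] at key
  rw [abs_sub_comm, shiftedGame, ← abs_mul, key, abs_mul]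
  congr 2 <;> ring

/-- No pair of strategies is `ε`-good for all four games whose equilibria are the corners of a
square around the equilibrium of `[a, b; c, d]`: a corner that is opposite to the quadrant of
`(x, y)` is at distance at least `σ` in both coordinates. -/
theorem exists_shiftedGame_lt_abs_sub {a b c d σ ε : ℝ} (h : IsCyclic a b c d) (hσ : 0 ≤ σ)
    (hgap : σ < gapMin a b c d) (hε : ε * |gameD a b c d| < σ ^ 2) (x y : Mixed 2) :
    ∃ r s : ℝ, (r = σ ∨ r = -σ) ∧ (s = σ ∨ s = -σ) ∧
      ε < |value (shiftedGame a b c d r s) - payoff (shiftedGame a b c d r s) x y| := by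
  have hfar : ∀ u : ℝ, ∃ r, (r = σ ∨ r = -σ) ∧ σ ≤ |u - r| := by
    intro u
    rcases le_total 0 u with hu | hu
    · exact ⟨-σ, .inr rfl, by rw [abs_of_nonneg (by linarith)]; linarith⟩
    · exact ⟨σ, .inl rfl, by rw [abs_of_nonpos (by linarith)]; linarith⟩
  have hlt : ∀ r, (r = σ ∨ r = -σ) → |r| < gapMin a b c d := by
    rintro r (rfl | rfl)
    · rwa [abs_of_nonneg hσ]
    · rwa [abs_neg, abs_of_nonneg hσ]
  obtain ⟨r, hr, hru⟩ := hfar (gameD a b c d * x.1 0 - (d - c))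
  obtain ⟨s, hs, hsv⟩ := hfar (gameD a b c d * y.1 0 - (d - b))
  refine ⟨r, s, hr, hs, ?_⟩
  have key := abs_gameD_mul_abs_value_shiftedGame_sub h (hlt r hr) (hlt s hs) x y
  have hprod := mul_le_mul hru hsv hσ (hσ.trans hru)
  rw [← key, mul_comm |gameD a b c d|] at hprod
  exact lt_of_mul_lt_mul_right (by nlinarith) (abs_nonneg (gameD a b c d))

end Game

namespace Algorithm

variable {m n : ℕ} (alg : Algorithm m n)

/-! ### The information inequality -/

/-- The difference `ω.2 s - mean A s ω` is the standard Gaussian noise of round `s`. -/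
theorem integrable_noise (A : Matrix (Fin m) (Fin n) ℝ) (s : ℕ) :
    Integrable (fun ω : alg.Run => ω.2 s - alg.mean A s ω) (alg.law A) := by
  have hmeas : Measurable fun ω : alg.Run => ω.2 s - alg.mean A s ω :=
    ((measurable_pi_apply s).comp measurable_snd).sub (alg.measurable_mean A s)
  rw [law, integrable_map_measure hmeas.aestronglyMeasurable
    (alg.measurable_observe A).aemeasurable]
  have hfun : (fun ω : alg.Run => ω.2 s - alg.mean A s ω) ∘
      (fun p : alg.Seed × (ℕ → ℝ) => (p.1, alg.observe A p.1 p.2)) = fun p => p.2 s := by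
    funext p
    simp only [Function.comp_apply, alg.observe_eq_mean_add A p.1 p.2 s, add_sub_cancel_left]
  rw [hfun]
  have hid : Integrable (fun x : ℝ => x) (gaussianReal 0 1) :=
    (memLp_id_gaussianReal 1).integrable (by simp)
  have hmp : MeasurePreserving (fun p : alg.Seed × (ℕ → ℝ) => p.2 s)
      (alg.seedLaw.prod noiseLaw) (gaussianReal 0 1) :=
    (measurePreserving_eval_infinitePi (fun _ : ℕ => gaussianReal 0 1) s).comp
      measurePreserving_snd
  exact hmp.integrable_comp_of_integrable hid

/-- The noise of round `s` is centred given the data available before that round. -/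
theorem integral_mul_noise (A : Matrix (Fin m) (Fin n) ℝ) (s : ℕ) {c : alg.Run → ℝ}
    (hc : Measurable c) (hdet : ∀ u y y', (∀ r < s, y r = y' r) → c (u, y) = c (u, y')) :
    ∫ ω, c ω * (ω.2 s - alg.mean A s ω) ∂alg.law A = 0 := by
  have hm := alg.measurable_observe A
  have hmeas : Measurable fun ω : alg.Run => c ω * (ω.2 s - alg.mean A s ω) :=
    hc.mul (((measurable_pi_apply s).comp measurable_snd).sub (alg.measurable_mean A s))
  have hmp := alg.measurePreserving_update_seed_noise s
  rw [law, integral_map hm.aemeasurable hmeas.aestronglyMeasurable]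
  simp only [alg.observe_eq_mean_add A _ _ s, add_sub_cancel_left]
  rw [← hmp.map_eq, integral_map hmp.measurable.aemeasurable]
  · have hcongr : ∀ p : (alg.Seed × (ℕ → ℝ)) × ℝ,
        c (p.1.1, alg.observe A p.1.1 (Function.update p.1.2 s p.2)) =
          c (p.1.1, alg.observe A p.1.1 p.1.2) := fun p =>
      hdet _ _ _ fun r hr => alg.observe_update_of_lt A _ _ _ hr
    simp only [hcongr, Function.update_self]
    rw [integral_prod_mul (fun p : alg.Seed × (ℕ → ℝ) => c (p.1, alg.observe A p.1 p.2))
      (fun x : ℝ => x), integral_id_gaussianReal, mul_zero]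
  · exact ((hc.comp hm).mul
      ((measurable_pi_apply s).comp measurable_snd)).aestronglyMeasurable

theorem exists_abs_mean_sub_mean_le (A B : Matrix (Fin m) (Fin n) ℝ) :
    ∃ K, ∀ s ω, |alg.mean A s ω - alg.mean B s ω| ≤ K := by
  obtain ⟨K, hK⟩ := Finite.exists_le fun q : Fin m × Fin n => |A q.1 q.2 - B q.1 q.2|
  exact ⟨K, fun s ω => hK _⟩

open Classical in
/-- The relative entropy of `A` against `B` accumulated by the rounds played before `min τ t`:
a round in which `(i, j)` is played contributes `(A i j - B i j) ^ 2 / 2`. -/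
def entropySum (A B : Matrix (Fin m) (Fin n) ℝ) (t : ℕ) (ω : alg.Run) : ℝ :=
  ∑ s ∈ Finset.range t, if (s : ℕ∞) < alg.stoppingTime ω then
    (alg.mean A s ω - alg.mean B s ω) ^ 2 / 2 else 0

theorem integrable_entropySum (A B C : Matrix (Fin m) (Fin n) ℝ) (t : ℕ) :
    Integrable (alg.entropySum A B t) (alg.law C) := by
  obtain ⟨K, hK⟩ := alg.exists_abs_mean_sub_mean_le A B
  refine integrable_finsetSum _ fun s _ => Integrable.of_bound (C := K ^ 2 / 2)
    (Measurable.ite (alg.measurableSet_lt_stoppingTime s) ((((alg.measurable_mean A s).sub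
      (alg.measurable_mean B s)).pow_const 2).div_const 2) measurable_const).aestronglyMeasurable
    (.of_forall fun ω => ?_)
  have h0 : 0 ≤ |alg.mean A s ω - alg.mean B s ω| := abs_nonneg _
  have h1 := pow_le_pow_left₀ h0 (hK s ω) 2
  rw [sq_abs] at h1
  rw [Real.norm_eq_abs]
  split_ifs
  · rw [abs_of_nonneg (by positivity)]
    linarith
  · rw [abs_zero]
    positivity

/-- Under `A`, the log-likelihood ratio is the accumulated relative entropy plus a martingale. -/
theorem integrable_logLR_and_integral_logLR (A B : Matrix (Fin m) (Fin n) ℝ) (t : ℕ) :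
    Integrable (alg.logLR A B t) (alg.law A) ∧
      ∫ ω, alg.logLR A B t ω ∂alg.law A = ∫ ω, alg.entropySum A B t ω ∂alg.law A := by
  classical
  obtain ⟨K, hK⟩ := alg.exists_abs_mean_sub_mean_le A B
  let c : ℕ → alg.Run → ℝ := fun s ω =>
    if (s : ℕ∞) < alg.stoppingTime ω then alg.mean A s ω - alg.mean B s ω else 0
  have hcm : ∀ s, Measurable (c s) := fun s =>
    Measurable.ite (alg.measurableSet_lt_stoppingTime s)
      ((alg.measurable_mean A s).sub (alg.measurable_mean B s)) measurable_const
  have hint : ∀ s, Integrable (fun ω => c s ω * (ω.2 s - alg.mean A s ω)) (alg.law A) := by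
    intro s
    refine (alg.integrable_noise A s).bdd_mul (c := K) (hcm s).aestronglyMeasurable
      (.of_forall fun ω => ?_)
    have := hK s ω
    simp only [c, Real.norm_eq_abs]
    split_ifs
    · exact this
    · simpa using (abs_nonneg _).trans this
  have hzero : ∀ s, ∫ ω, c s ω * (ω.2 s - alg.mean A s ω) ∂alg.law A = 0 := fun s =>
    alg.integral_mul_noise A s (hcm s) fun u y y' h => by
      simp only [c, alg.lt_stoppingTime_congr u h, alg.mean_congr A u h, alg.mean_congr B u h]
  have hsplit : alg.logLR A B t = fun ω =>
      (∑ s ∈ Finset.range t, c s ω * (ω.2 s - alg.mean A s ω)) + alg.entropySum A B t ω := by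
    funext ω
    rw [logLR, entropySum, ← Finset.sum_add_distrib]
    refine Finset.sum_congr rfl fun s _ => ?_
    simp only [c]
    split_ifs
    · ring
    · ring
  have hsum : Integrable
      (fun ω => ∑ s ∈ Finset.range t, c s ω * (ω.2 s - alg.mean A s ω)) (alg.law A) :=
    integrable_finsetSum _ fun s _ => hint s
  have hent := alg.integrable_entropySum A B A t
  rw [hsplit]
  refine ⟨hsum.add hent, ?_⟩
  rw [integral_add hsum hent, integral_finsetSum _ fun s _ => hint s,
    Finset.sum_eq_zero fun s _ => hzero s, zero_add]

/-- An event that is decided by time `min τ t` and has probability at most `δ` under `B` can only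
be likely under `A` if a lot of relative entropy has been accumulated. -/
theorem measureReal_mul_log_sub_le_integral_entropySum (A B : Matrix (Fin m) (Fin n) ℝ) (t : ℕ)
    {R : Set alg.Run} (hR : MeasurableSet R) (hdet : alg.DeterminedBy t fun ω => ω ∈ R)
    {δ : ℝ} (hδ : 0 < δ) (hB : alg.law B R ≤ ENNReal.ofReal δ) :
    (alg.law A).real R * Real.log (1 / δ) - Real.log 2 ≤
      ∫ ω, alg.entropySum A B t ω ∂alg.law A := by
  classical
  obtain ⟨hLint, hLeq⟩ := alg.integrable_logLR_and_integral_logLR A B t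
  rw [← hLeq]
  -- The weight `δ⁻¹` on `R` balances the probability of `R` under `B`.
  let f : alg.Run → ℝ := fun ω => if ω ∈ R then δ⁻¹ else 1
  have hf0 : ∀ ω, 0 ≤ f ω := fun ω => by
    simp only [f]
    split_ifs <;> positivity
  have hfm : Measurable f := Measurable.ite hR measurable_const measurable_const
  have hchange := alg.lintegral_law_eq_lintegral_logLR A B t (f := fun ω => ENNReal.ofReal (f ω))
    hfm.ennreal_ofReal fun u y y' h => by
      have : (u, y) ∈ R ↔ (u, y') ∈ R := iff_of_eq (hdet u y y' h)
      simp only [f, this]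
  have hle2 : ∫⁻ ω, ENNReal.ofReal (f ω) ∂alg.law B ≤ 2 := by
    calc ∫⁻ ω, ENNReal.ofReal (f ω) ∂alg.law B
        ≤ ∫⁻ ω, (R.indicator (fun _ => ENNReal.ofReal δ⁻¹) ω + 1) ∂alg.law B := by
          refine lintegral_mono fun ω => ?_
          by_cases hω : ω ∈ R <;> simp [f, hω]
      _ = ENNReal.ofReal δ⁻¹ * alg.law B R + 1 := by
          rw [lintegral_add_right _ measurable_const, lintegral_indicator_const hR]
          simp
      _ ≤ ENNReal.ofReal δ⁻¹ * ENNReal.ofReal δ + 1 := by gcongr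
      _ = 2 := by
          rw [← ENNReal.ofReal_mul (by positivity), inv_mul_cancel₀ hδ.ne', ENNReal.ofReal_one]
          norm_num
  let X : alg.Run → ℝ := fun ω =>
    (R.indicator (fun _ => Real.log (1 / δ)) ω - Real.log 2) - alg.logLR A B t ω
  have hind : Integrable (R.indicator fun _ : alg.Run => Real.log (1 / δ)) (alg.law A) :=
    (integrable_const _).indicator hR
  have hXint : Integrable X (alg.law A) := (hind.sub (integrable_const _)).sub hLint
  have hexp : ∀ ω, Real.exp (X ω) = f ω * Real.exp (-alg.logLR A B t ω) * 2⁻¹ := by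
    intro ω
    have h1 : Real.exp (R.indicator (fun _ => Real.log (1 / δ)) ω) = f ω := by
      by_cases hω : ω ∈ R
      · simp [f, hω, Real.exp_neg, Real.exp_log hδ]
      · simp [f, hω]
    simp only [X]
    rw [sub_eq_add_neg, Real.exp_add, Real.exp_sub, h1, Real.exp_log two_pos]
    ring
  have hexp_le : ∫⁻ ω, ENNReal.ofReal (Real.exp (X ω)) ∂alg.law A ≤ 1 := by
    have : ∀ ω, ENNReal.ofReal (Real.exp (X ω)) = ENNReal.ofReal (f ω) *
        ENNReal.ofReal (Real.exp (-alg.logLR A B t ω)) * 2⁻¹ := by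
      intro ω
      rw [hexp, ENNReal.ofReal_mul (mul_nonneg (hf0 ω) (Real.exp_nonneg _)),
        ENNReal.ofReal_mul (hf0 ω), ENNReal.ofReal_inv_of_pos two_pos]
      simp
    simp only [this]
    rw [lintegral_mul_const' _ _ (by simp), ← hchange]
    calc _ ≤ (2 : ℝ≥0∞) * 2⁻¹ := by gcongr
      _ = 1 := ENNReal.mul_inv_cancel (by simp) (by simp)
  have hexpint : Integrable (fun ω => Real.exp (X ω)) (alg.law A) := by
    refine ⟨Real.continuous_exp.comp_aestronglyMeasurable hXint.aestronglyMeasurable, ?_⟩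
    rw [hasFiniteIntegral_iff_ofReal (.of_forall fun ω => Real.exp_nonneg _)]
    exact hexp_le.trans_lt ENNReal.one_lt_top
  have hexp1 : ∫ ω, Real.exp (X ω) ∂alg.law A ≤ 1 := by
    rw [integral_eq_lintegral_of_nonneg_ae (.of_forall fun ω => Real.exp_nonneg _)
      hexpint.aestronglyMeasurable]
    exact ENNReal.toReal_le_of_le_ofReal zero_le_one (by simpa using hexp_le)
  have hX : ∫ ω, X ω ∂alg.law A + 1 ≤ 1 := by
    calc ∫ ω, X ω ∂alg.law A + 1 = ∫ ω, (X ω + 1) ∂alg.law A := by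
          rw [integral_add hXint (integrable_const _)]
          simp
      _ ≤ ∫ ω, Real.exp (X ω) ∂alg.law A :=
          integral_mono (hXint.add (integrable_const _)) hexpint fun ω => Real.add_one_le_exp _
      _ ≤ 1 := hexp1
  have hXeq : ∫ ω, X ω ∂alg.law A = (alg.law A).real R * Real.log (1 / δ) - Real.log 2 -
      ∫ ω, alg.logLR A B t ω ∂alg.law A := by
    simp only [X]
    have h1 : Integrable (fun ω : alg.Run =>
        R.indicator (fun _ => Real.log (1 / δ)) ω - Real.log 2) (alg.law A) :=
      hind.sub (integrable_const _)
    rw [integral_sub h1 hLint, integral_sub hind (integrable_const _),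
      integral_indicator_const _ hR]
    simp
  linarith

/-! ### Errors -/

theorem measurableSet_stoppingTime_eq (t : ℕ) :
    MeasurableSet {ω : alg.Run | alg.stoppingTime ω = t} := by
  cases t with
  | zero =>
    have : {ω : alg.Run | alg.stoppingTime ω = (0 : ℕ)} =
        {ω | ((0 : ℕ) : ℕ∞) < alg.stoppingTime ω}ᶜ := by
      ext ω
      simp
    rw [this]
    exact (alg.measurableSet_lt_stoppingTime 0).compl
  | succ t =>
    have : {ω : alg.Run | alg.stoppingTime ω = (t + 1 : ℕ)} =
        {ω | (t : ℕ∞) < alg.stoppingTime ω} \ {ω | ((t + 1 : ℕ) : ℕ∞) < alg.stoppingTime ω} := by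
      ext ω
      simp only [Set.mem_ofPred_eq, Set.mem_sdiff, not_lt]
      rw [← ENat.add_one_le_iff (ENat.natCast_ne_top t), le_antisymm_iff, and_comm]
      push_cast
      rfl
    rw [this]
    exact (alg.measurableSet_lt_stoppingTime t).diff (alg.measurableSet_lt_stoppingTime (t + 1))

theorem measurableSet_returnsGood (A : Matrix (Fin m) (Fin n) ℝ) (ε : ℝ) :
    MeasurableSet {ω | alg.ReturnsGood A ε ω} := by
  simp only [ReturnsGood, Set.ofPred_exists]
  refine .iUnion fun t => (alg.measurableSet_stoppingTime_eq t).inter ?_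
  have hpay : Measurable fun ω => payoff A (alg.output t (alg.history t ω)).1
      (alg.output t (alg.history t ω)).2 :=
    (continuous_payoff A).measurable.comp ((alg.measurable_output t).comp (alg.measurable_history t))
  exact measurableSet_le (measurable_const.sub hpay).abs measurable_const

/-- The runs that stop before round `t` with an output that is not `ε`-good for `A`. -/
def errorBefore (A : Matrix (Fin m) (Fin n) ℝ) (ε : ℝ) (t : ℕ) : Set alg.Run :=
  {ω | alg.stoppingTime ω < t ∧ ¬ alg.ReturnsGood A ε ω}

theorem measurableSet_stoppingTime_lt (t : ℕ) :
    MeasurableSet {ω : alg.Run | alg.stoppingTime ω < t} := by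
  have : {ω : alg.Run | alg.stoppingTime ω < t} =
      ⋃ s : ℕ, ⋃ _ : s < t, {ω | alg.stoppingTime ω = s} := by
    ext ω
    simp only [Set.mem_ofPred_eq, Set.mem_iUnion, exists_prop]
    constructor
    · intro h
      obtain ⟨s, hs⟩ := ENat.ne_top_iff_exists.1 h.ne_top
      rw [← hs] at h
      exact ⟨s, by exact_mod_cast h, hs.symm⟩
    · rintro ⟨s, hst, hs⟩
      rw [hs]
      exact_mod_cast hst
  rw [this]
  exact .iUnion fun s => .iUnion fun _ => alg.measurableSet_stoppingTime_eq s

theorem measurableSet_errorBefore (A : Matrix (Fin m) (Fin n) ℝ) (ε : ℝ) (t : ℕ) :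
    MeasurableSet (alg.errorBefore A ε t) :=
  (alg.measurableSet_stoppingTime_lt t).inter (alg.measurableSet_returnsGood A ε).compl

theorem determinedBy_errorBefore (A : Matrix (Fin m) (Fin n) ℝ) (ε : ℝ) (t : ℕ) :
    alg.DeterminedBy t fun ω => ω ∈ alg.errorBefore A ε t := by
  intro u y y' h
  have hlt : ∀ s ≤ t, ((s : ℕ∞) < alg.stoppingTime (u, y) ↔
      (s : ℕ∞) < alg.stoppingTime (u, y')) := fun s hs =>
    alg.lt_stoppingTime_congr_of_agree h hs
  have heq : ∀ s < t, (alg.stoppingTime (u, y) = s ↔ alg.stoppingTime (u, y') = s) := by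
    have hiff : ∀ (s : ℕ) (x : ℕ∞), x = s ↔ ¬ (s : ℕ∞) < x ∧ ∀ r < s, (r : ℕ∞) < x := by
      intro s x
      constructor
      · rintro rfl
        exact ⟨lt_irrefl _, fun r hr => by exact_mod_cast hr⟩
      · rintro ⟨h1, h2⟩
        obtain ⟨k, rfl⟩ := ENat.ne_top_iff_exists.1
          (ne_top_of_le_ne_top (ENat.natCast_ne_top s) (not_lt.1 h1))
        norm_cast at h1 h2 ⊢
        by_contra hks
        exact lt_irrefl k (by exact_mod_cast h2 k (by omega))
    intro s hs
    rw [hiff, hiff, hlt s hs.le]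
    refine and_congr_right fun _ => forall₂_congr fun r hr => hlt r (hr.trans hs).le
  have hiff : ∀ ω, ω ∈ alg.errorBefore A ε t ↔ ∃ s < t, alg.stoppingTime ω = s ∧
      ε < |value A - payoff A (alg.output s (alg.history s ω)).1
        (alg.output s (alg.history s ω)).2| := by
    intro ω
    constructor
    · rintro ⟨hτ, hbad⟩
      obtain ⟨s, hs⟩ := ENat.ne_top_iff_exists.1 hτ.ne_top
      rw [← hs] at hτ
      exact ⟨s, by exact_mod_cast hτ, hs.symm,
        not_le.1 fun hle => hbad ⟨s, hs.symm, hle⟩⟩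
    · rintro ⟨s, hst, hs, hbad⟩
      refine ⟨by rw [hs]; exact_mod_cast hst, ?_⟩
      rintro ⟨r, hr, hle⟩
      rw [hs] at hr
      obtain rfl : s = r := by exact_mod_cast hr
      exact hle.not_gt hbad
  simp only [hiff, eq_iff_iff]
  refine exists_congr fun s => and_congr_right fun hst => ?_
  rw [← heq s hst]
  refine and_congr_right fun hs => ?_
  rw [alg.history_congr u fun r hr => h r (hr.trans hst) (by rw [hs]; exact_mod_cast hr)]

theorem law_errorBefore_le {ε δ : ℝ} (halg : alg.IsPACGood ε δ)
    (A : Matrix (Fin m) (Fin n) ℝ) (t : ℕ) :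
    alg.law A (alg.errorBefore A ε t) ≤ ENNReal.ofReal δ := by
  have h1 : alg.law A (alg.errorBefore A ε t) ≤ alg.law A {ω | alg.ReturnsGood A ε ω}ᶜ :=
    measure_mono fun ω hω => hω.2
  refine h1.trans ?_
  rw [prob_compl_eq_one_sub (alg.measurableSet_returnsGood A ε), tsub_le_iff_right]
  calc (1 : ℝ≥0∞) = ENNReal.ofReal (δ + (1 - δ)) := by simp
    _ ≤ ENNReal.ofReal δ + ENNReal.ofReal (1 - δ) := ENNReal.ofReal_add_le
    _ ≤ _ := by gcongr; exact (halg A).2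

theorem tendsto_law_stoppingTime_lt {A : Matrix (Fin m) (Fin n) ℝ}
    (hA : ∀ᵐ ω ∂alg.law A, alg.stoppingTime ω < ⊤) :
    Filter.Tendsto (fun t : ℕ => (alg.law A).real {ω | alg.stoppingTime ω < t}) Filter.atTop
      (nhds 1) := by
  have hmono : Monotone fun t : ℕ => {ω : alg.Run | alg.stoppingTime ω < t} :=
    fun s t hst ω hω => lt_of_lt_of_le (show alg.stoppingTime ω < s from hω) (by exact_mod_cast hst)
  have h := tendsto_measure_iUnion_atTop (μ := alg.law A) hmono
  have huniv : alg.law A (⋃ t : ℕ, {ω : alg.Run | alg.stoppingTime ω < t}) = 1 := by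
    rw [← measure_univ (μ := alg.law A)]
    refine measure_congr ?_
    filter_upwards [hA] with ω hω
    obtain ⟨s, hs⟩ := ENat.ne_top_iff_exists.1 hω.ne
    refine eq_true ?_ |>.trans (eq_true (Set.mem_univ ω)).symm
    refine Set.mem_iUnion.2 ⟨s + 1, ?_⟩
    rw [Set.mem_ofPred_eq, ← hs]
    exact_mod_cast Nat.lt_succ_self s
  rw [huniv] at h
  exact (ENNReal.tendsto_toReal ENNReal.one_ne_top).comp h

open Classical in
/-- The number of rounds before `t` that are played before the algorithm stops, which is
`min τ t`. -/
def roundsBefore (t : ℕ) (ω : alg.Run) : ℝ :=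
  ∑ s ∈ Finset.range t, if (s : ℕ∞) < alg.stoppingTime ω then 1 else 0

theorem ofReal_integral_roundsBefore_le_expectedStoppingTime (A : Matrix (Fin m) (Fin n) ℝ)
    (t : ℕ) :
    ENNReal.ofReal (∫ ω, alg.roundsBefore t ω ∂alg.law A) ≤ alg.expectedStoppingTime A := by
  classical
  have hnn : ∀ ω, 0 ≤ alg.roundsBefore t ω := fun ω =>
    Finset.sum_nonneg fun s _ => by split_ifs <;> simp
  refine (ENNReal.ofReal_le_ofReal (le_of_eq (integral_eq_lintegral_of_nonneg_ae
    (.of_forall hnn) (Finset.measurable_sum _ fun s _ => Measurable.ite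
      (alg.measurableSet_lt_stoppingTime s) measurable_const
      measurable_const).aestronglyMeasurable))).trans (ENNReal.ofReal_toReal_le.trans ?_)
  refine lintegral_mono fun ω => ?_
  rw [roundsBefore, Finset.sum_ite, Finset.sum_const_zero, add_zero, Finset.sum_const, nsmul_eq_mul, mul_one,
    ENNReal.ofReal_natCast]
  have hcard : (((Finset.range t).filter fun s : ℕ => (s : ℕ∞) < alg.stoppingTime ω).card : ℕ∞) ≤
      alg.stoppingTime ω := by
    cases hτ : alg.stoppingTime ω with
    | top => exact le_top
    | coe k =>
      norm_cast
      calc _ ≤ (Finset.range k).card := Finset.card_le_card fun s hs => by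
            simpa using (Finset.mem_filter.1 hs).2
        _ = k := Finset.card_range k
  rw [← ENat.toENNReal_coe]
  exact ENat.toENNReal_le.2 hcard

/-- Each entry of the game is moved by `σ` in two of the four alternatives, and not at all in the
other two. -/
theorem sum_entropySum_shiftedGame (alg : Algorithm 2 2) (a b c d σ : ℝ) (t : ℕ) (ω : alg.Run) :
    alg.entropySum !![a, b; c, d] (shiftedGame a b c d σ σ) t ω +
      alg.entropySum !![a, b; c, d] (shiftedGame a b c d (-σ) (-σ)) t ω +
      (alg.entropySum !![a, b; c, d] (shiftedGame a b c d σ (-σ)) t ω +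
        alg.entropySum !![a, b; c, d] (shiftedGame a b c d (-σ) σ) t ω) =
      σ ^ 2 * alg.roundsBefore t ω := by
  classical
  simp only [entropySum, roundsBefore, ← Finset.sum_add_distrib, Finset.mul_sum]
  refine Finset.sum_congr rfl fun s _ => ?_
  by_cases hrun : (s : ℕ∞) < alg.stoppingTime ω
  · simp only [hrun, if_true, mean]
    generalize alg.sample s (alg.history s ω) = q
    obtain ⟨i, j⟩ := q
    fin_cases i <;> fin_cases j <;> simp [shiftedGame] <;> ring
  · simp [hrun]

theorem measureReal_stoppingTime_lt_le (alg : Algorithm 2 2) {a b c d σ ε : ℝ}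
    (h : IsCyclic a b c d) (hσ : 0 ≤ σ) (hgap : σ < gapMin a b c d)
    (hε : ε * |gameD a b c d| < σ ^ 2) (A : Matrix (Fin 2) (Fin 2) ℝ) (t : ℕ) :
    (alg.law A).real {ω | alg.stoppingTime ω < t} ≤
      (alg.law A).real (alg.errorBefore (shiftedGame a b c d σ σ) ε t) +
        (alg.law A).real (alg.errorBefore (shiftedGame a b c d (-σ) (-σ)) ε t) +
      ((alg.law A).real (alg.errorBefore (shiftedGame a b c d σ (-σ)) ε t) +
        (alg.law A).real (alg.errorBefore (shiftedGame a b c d (-σ) σ) ε t)) := by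
  have hsub : {ω | alg.stoppingTime ω < t} ⊆
      (alg.errorBefore (shiftedGame a b c d σ σ) ε t ∪
        alg.errorBefore (shiftedGame a b c d (-σ) (-σ)) ε t) ∪
      (alg.errorBefore (shiftedGame a b c d σ (-σ)) ε t ∪
        alg.errorBefore (shiftedGame a b c d (-σ) σ) ε t) := by
    intro ω hω
    obtain ⟨k, hk⟩ := ENat.ne_top_iff_exists.1 (ne_top_of_lt (show alg.stoppingTime ω < t from hω))
    obtain ⟨r, s, hr, hs, hbad⟩ := exists_shiftedGame_lt_abs_sub h hσ hgap hε
      (alg.output k (alg.history k ω)).1 (alg.output k (alg.history k ω)).2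
    have hmem : ω ∈ alg.errorBefore (shiftedGame a b c d r s) ε t := by
      refine ⟨hω, ?_⟩
      rintro ⟨l, hl, hgood⟩
      rw [← hk] at hl
      obtain rfl : k = l := by exact_mod_cast hl
      exact hgood.not_gt hbad
    rcases hr with rfl | rfl <;> rcases hs with rfl | rfl
    · exact .inl (.inl hmem)
    · exact .inr (.inl hmem)
    · exact .inr (.inr hmem)
    · exact .inl (.inr hmem)
  refine (measureReal_mono hsub).trans ((measureReal_union_le _ _).trans ?_)
  exact add_le_add (measureReal_union_le _ _) (measureReal_union_le _ _)

/-- The four information inequalities, added up. -/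
theorem ofReal_le_expectedStoppingTime (alg : Algorithm 2 2) {a b c d σ ε δ : ℝ}
    (h : IsCyclic a b c d) (hσ : 0 < σ) (hgap : σ < gapMin a b c d)
    (hε : ε * |gameD a b c d| < σ ^ 2) (hδ : 0 < δ) (hδ1 : δ < 1) (halg : alg.IsPACGood ε δ)
    (t : ℕ) :
    ENNReal.ofReal (((alg.law !![a, b; c, d]).real {ω | alg.stoppingTime ω < t} *
        Real.log (1 / δ) - 4 * Real.log 2) / σ ^ 2) ≤
      alg.expectedStoppingTime !![a, b; c, d] := by
  refine le_trans (ENNReal.ofReal_le_ofReal ?_)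
    (alg.ofReal_integral_roundsBefore_le_expectedStoppingTime !![a, b; c, d] t)
  have hinfo : ∀ r s, _ := fun r s =>
    alg.measureReal_mul_log_sub_le_integral_entropySum !![a, b; c, d] (shiftedGame a b c d r s) t
      (alg.measurableSet_errorBefore (shiftedGame a b c d r s) ε t)
      (alg.determinedBy_errorBefore (shiftedGame a b c d r s) ε t) hδ
      (alg.law_errorBefore_le halg (shiftedGame a b c d r s) t)
  have hint : ∀ r s, Integrable (alg.entropySum !![a, b; c, d] (shiftedGame a b c d r s) t)
      (alg.law !![a, b; c, d]) := fun r s => alg.integrable_entropySum _ _ _ t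
  have hlog : 0 ≤ Real.log (1 / δ) := Real.log_nonneg (by rw [le_div_iff₀ hδ]; linarith)
  have hprob := mul_le_mul_of_nonneg_right
    (alg.measureReal_stoppingTime_lt_le h hσ.le hgap hε !![a, b; c, d] t) hlog
  have hsum : σ ^ 2 * ∫ ω, alg.roundsBefore t ω ∂alg.law !![a, b; c, d] =
      ∫ ω, alg.entropySum !![a, b; c, d] (shiftedGame a b c d σ σ) t ω ∂alg.law !![a, b; c, d] +
        ∫ ω, alg.entropySum !![a, b; c, d] (shiftedGame a b c d (-σ) (-σ)) t ω
          ∂alg.law !![a, b; c, d] +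
      (∫ ω, alg.entropySum !![a, b; c, d] (shiftedGame a b c d σ (-σ)) t ω
          ∂alg.law !![a, b; c, d] +
        ∫ ω, alg.entropySum !![a, b; c, d] (shiftedGame a b c d (-σ) σ) t ω
          ∂alg.law !![a, b; c, d]) := by
    rw [← integral_const_mul, ← integral_add' (hint _ _) (hint _ _),
      ← integral_add' (hint _ _) (hint _ _), ← integral_add' ((hint _ _).add (hint _ _))
        ((hint _ _).add (hint _ _))]
    exact integral_congr_ae (.of_forall fun ω =>
      (alg.sum_entropySum_shiftedGame a b c d σ t ω).symm)
  rw [div_le_iff₀' (by positivity), hsum]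
  linarith [hinfo σ σ, hinfo (-σ) (-σ), hinfo σ (-σ), hinfo (-σ) σ]

end Algorithm

end MatrixGame

end

theorem theorem1 (a b c d : ℝ)
    (hA : MatrixGame.HasUniqueNonpureNash !![a, b; c, d])
    (ε : ℝ)
    (hε : ε ∈ Set.Ioo 0 (MatrixGame.gapMin a b c d ^ 2 / (3 * |MatrixGame.gameD a b c d|)))
    (δ : ℝ) (hδ : δ ∈ Set.Ioo (0 : ℝ) 1)
    (alg : MatrixGame.Algorithm 2 2) (halg : alg.IsPACGood ε δ) :
    ENNReal.ofReal (Real.log (1 / (30 * δ)) / (3 * ε * |MatrixGame.gameD a b c d|)) ≤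
      alg.expectedStoppingTime !![a, b; c, d] := by
  obtain ⟨hε0, hε1⟩ := hε
  obtain ⟨hδ0, hδ1⟩ := hδ
  have hcyc := hA.isCyclic
  have hD : 0 < |MatrixGame.gameD a b c d| := abs_pos.2 hcyc.gameD_ne_zero
  have hpos : 0 < 3 * ε * |MatrixGame.gameD a b c d| := by positivity
  have hgap0 : 0 ≤ MatrixGame.gapMin a b c d := by
    unfold MatrixGame.gapMin
    positivity
  rw [lt_div_iff₀ (by positivity)] at hε1
  -- The upper bound on `ε` says that `σ = √(3 ε |D|)` is smaller than the gap.
  have hσ2 : √(3 * ε * |MatrixGame.gameD a b c d|) ^ 2 = 3 * ε * |MatrixGame.gameD a b c d| :=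
    Real.sq_sqrt hpos.le
  have hbound := alg.ofReal_le_expectedStoppingTime hcyc (Real.sqrt_pos.2 hpos)
    ((Real.sqrt_lt' (lt_of_le_of_ne hgap0 fun h0 => by rw [← h0] at hε1; nlinarith)).2
      (by linarith)) (by rw [hσ2]; nlinarith) hδ0 hδ1 halg
  rw [hσ2] at hbound
  have hlim := (ENNReal.continuous_ofReal.tendsto _).comp
    ((((alg.tendsto_law_stoppingTime_lt (halg !![a, b; c, d]).1).mul_const
      (Real.log (1 / δ))).sub_const (4 * Real.log 2)).div_const
        (3 * ε * |MatrixGame.gameD a b c d|))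
  refine le_trans (ENNReal.ofReal_le_ofReal ?_) (le_of_tendsto' hlim hbound)
  gcongr
  have h16 : 4 * Real.log 2 = Real.log 16 := by
    rw [show (16 : ℝ) = 2 ^ 4 by norm_num, Real.log_pow]
    norm_num
  have h30 : Real.log 16 ≤ Real.log 30 := Real.log_le_log (by norm_num) (by norm_num)
  rw [one_mul, h16, one_div, one_div, Real.log_inv, Real.log_inv,
    Real.log_mul (by norm_num) hδ0.ne']
  linarith
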